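/- There is a universal constant $C>0$ such that the following holds. Let $(\boldsymbol x,y)$ have a joint law $p(\boldsymbol x,y)$ on $\mathcal X\times\{0,1\}$ ($\mathcal X$ any measurable space, e.g. $\mathcal X\subseteq\mathbb R^d$), with class prior $\pi_P=\Pr(y=1)>0$; let $p_P$ be the law of $\boldsymbol x$ given $y=1$ and $p_U$ the marginal law of $\boldsymbol x$. Let $\mathcal F$ be a pointwise measurable class of functions $f:\mathcal X\to\mathbb R$ (all members are measurable, and each is the pointwise limit of a sequence from one fixed countable subclass) that is $b$-uniformly bounded ($|f(\boldsymbol x)|\le b$ for all $f\in\mathcal F$, $\boldsymbol x\in\mathcal X$) and has finite VC dimension $\mathcal V$, i.e. the family of subgraphs $\{(\boldsymbol x,t): t<f(\boldsymbol x)\}$, $f\in\mathcal F$, has VC dimension $\mathcal V$. Let $\boldsymbol X_L$ be $n_L\ge1$ i.i.d. draws from $p_P$, $\boldsymbol X_U$ be $n_U\ge1$ i.i.d. draws from $p_U$, and let $0<\delta<1$. For $f\in\mathcal F$ put $\hat y=\frac12(\operatorname{sgn} f(\boldsymbol x)+1)$, $s=s(\boldsymbol x)=1/(1+e^{-f(\boldsymbol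 x)})$, let $$R=\Pr_{(\boldsymbol x,y)\sim p}\left[\hat y\neq y\right]$$ be the expected zero-one risk (a tie $f(\boldsymbol x)=0$ counts as an error), and let $$\hat R_{lab}=2\pi_P\left|\frac1{n_L}\sum_{\boldsymbol x\in\boldsymbol X_L}s(\boldsymbol x)-1\right|+\left|\frac1{n_U}\sum_{\boldsymbol x\in\boldsymbol X_U}s(\boldsymbol x)-\pi_P\right| .$$ Then, with probability at least $1-\delta$ over the samples, simultaneously for all $f\in\mathcal F$, $$R\le 2\hat R_{lab}+8\pi_P\,C\sqrt{\frac{\mathcal V}{n_L}}+12\pi_P\,\varepsilon(\delta,n_L)+4C\sqrt{\frac{\mathcal V}{n_U}}+6\,\varepsilon(\delta,n_U),\qquad \varepsilon(\delta,n)=\min(b,1)\sqrt{\frac{\log(2/\delta)}{2n}} .$$ -/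

import Mathlib

open MeasureTheory ProbabilityTheory Filter Topology

namespace DistPU

/-- A family `𝒞` of subsets of `α` shatters the finite set `s` if every subset of `s` is cut out of
`s` by some member of `𝒞`. -/
def Shatters {α : Type*} (𝒞 : Set (Set α)) (s : Finset α) : Prop :=
  ∀ t : Finset α, t ⊆ s → ∃ c ∈ 𝒞, ∀ a ∈ s, a ∈ c ↔ a ∈ t

/-- The Vapnik-Chervonenkis dimension of a family of sets: the supremum of the cardinalities of the
finite sets that it shatters. -/
noncomputable def setVCDim {α : Type*} (𝒞 : Set (Set α)) : ℕ∞ :=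
  ⨆ (s : Finset α) (_ : Shatters 𝒞 s), (s.card : ℕ∞)

/-- The subgraph `{(x, t) | t < f x}` of a real function. -/
def subgraph {X : Type*} (f : X → ℝ) : Set (X × ℝ) := {p | p.2 < f p.1}

/-- The VC dimension of a class of real functions: the VC dimension of its family of subgraphs. -/
noncomputable def vcDim {X : Type*} (F : Set (X → ℝ)) : ℕ∞ := setVCDim (subgraph '' F)

/-- `F` is `b`-uniformly bounded. -/
def UniformlyBounded {X : Type*} (F : Set (X → ℝ)) (b : ℝ) : Prop :=
  ∀ f ∈ F, ∀ x, |f x| ≤ b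

/-- The usual measurability condition on a function class: its members are measurable, and each of
them is the pointwise limit of a sequence from one countable subclass. -/
def PointwiseMeasurable {X : Type*} [MeasurableSpace X] (F : Set (X → ℝ)) : Prop :=
  (∀ f ∈ F, Measurable f) ∧
    ∃ F₀ : Set (X → ℝ), F₀ ⊆ F ∧ F₀.Countable ∧
      ∀ f ∈ F, ∃ g : ℕ → X → ℝ, (∀ k, g k ∈ F₀) ∧
        ∀ x, Tendsto (fun k => g k x) atTop (𝓝 (f x))

section Distribution

variable {X : Type*} [MeasurableSpace X]

/-- The class prior `π_P = Pr(y = 1)` of a joint law `P` of input and label. -/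
noncomputable def classPrior (P : Measure (X × Fin 2)) : ℝ := P.real {z | z.2 = 1}

/-- The class-conditional law `p_P` of the input given `y = 1`. -/
noncomputable def posLaw (P : Measure (X × Fin 2)) : Measure X :=
  (ProbabilityTheory.cond P {z | z.2 = 1}).map Prod.fst

/-- The marginal law `p = p_U` of the input. -/
noncomputable def inputLaw (P : Measure (X × Fin 2)) : Measure X := P.map Prod.fst

/-- The predicted label `ŷ = (sgn (f x) + 1) / 2`. On a tie `f x = 0` it is `1 / 2`, which is
neither label, so that ties count as errors whatever the true label; this makes the risk below at
least as large as under either convention `sgn 0 = ± 1`. -/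
noncomputable def predictedLabel (f : X → ℝ) (x : X) : ℝ := (Real.sign (f x) + 1) / 2

open Classical in
/-- The zero-one error: `0` if the two labels agree, and `1` otherwise. -/
noncomputable def zeroOneError (y' y : ℝ) : ℝ := if y' = y then 0 else 1

/-- The expected risk `R` of (the classifier given by) `f`. -/
noncomputable def expectedRisk (P : Measure (X × Fin 2)) (f : X → ℝ) : ℝ :=
  ∫ z, zeroOneError (predictedLabel f z.1) ((z.2 : ℕ) : ℝ) ∂P

end Distribution

/-- The mean over a sample of the scores `s = 1 / (1 + exp (-f x))`. -/
noncomputable def meanScore {X : Type*} (f : X → ℝ) {n : ℕ} (x : Fin n → X) : ℝ :=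
  (1 / (n : ℝ)) * ∑ i, 1 / (1 + Real.exp (-f (x i)))

/-- The empirical label distribution alignment risk, for the class prior `π`, of `f` on the labeled
positive sample `xL` and the unlabeled sample `xU`. -/
noncomputable def empiricalLabRisk {X : Type*} (π : ℝ) (f : X → ℝ) {nL nU : ℕ}
    (xL : Fin nL → X) (xU : Fin nU → X) : ℝ :=
  2 * π * |meanScore f xL - 1| + |meanScore f xU - π|

/-- The confidence term `ε(δ, n)`. -/
noncomputable def confidenceTerm (b δ : ℝ) (n : ℕ) : ℝ :=
  min b 1 * Real.sqrt (Real.log (2 / δ) / (2 * n))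

/-- `x 0, …, x (n - 1)` is an i.i.d. sample from the law `ν`. -/
def IsIIDSample {Ω X : Type*} [MeasurableSpace Ω] [MeasurableSpace X] (μ : Measure Ω) {n : ℕ}
    (x : Fin n → Ω → X) (ν : Measure X) : Prop :=
  (∀ i, Measurable (x i)) ∧ iIndepFun x μ ∧ ∀ i, μ.map (x i) = ν

end DistPU

namespace DistPU

section Packing

open Finset
open scoped symmDiff

/-- The Sauer–Shelah bound in exponential form. -/
lemma card_mul_pow_le_exp {α : Type*} [Fintype α] [DecidableEq α] {𝒜 : Finset (Finset α)} {V : ℕ}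
    (h𝒜 : 𝒜.vcDim ≤ V) {x : ℝ} (hx : 0 < x) (hx1 : x ≤ 1) :
    (#𝒜 : ℝ) * x ^ V ≤ Real.exp (x * Fintype.card α) := by
  have hcard : #𝒜 ≤ ∑ k ∈ Iic 𝒜.vcDim, (Fintype.card α).choose k :=
    𝒜.card_le_card_shatterer.trans card_shatterer_le_sum_vcDim
  have hdim : 𝒜.vcDim ≤ Fintype.card α := Finset.sup_le fun s _ => card_le_univ s
  calc (#𝒜 : ℝ) * x ^ V
      ≤ (∑ k ∈ Iic 𝒜.vcDim, ((Fintype.card α).choose k : ℝ)) * x ^ V := by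
        gcongr
        exact_mod_cast hcard
    _ = ∑ k ∈ Iic 𝒜.vcDim, ((Fintype.card α).choose k : ℝ) * x ^ V := by rw [sum_mul]
    _ ≤ ∑ k ∈ Iic 𝒜.vcDim, x ^ k * ((Fintype.card α).choose k : ℝ) := by
        refine sum_le_sum fun k hk => ?_
        rw [mul_comm]
        exact mul_le_mul_of_nonneg_right
          (pow_le_pow_of_le_one hx.le hx1 ((mem_Iic.1 hk).trans h𝒜)) (by positivity)
    _ ≤ ∑ k ∈ range (Fintype.card α + 1), x ^ k * ((Fintype.card α).choose k : ℝ) := by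
        refine sum_le_sum_of_subset_of_nonneg (fun k hk => ?_) fun _ _ _ => by positivity
        have := mem_Iic.1 hk
        simp only [mem_range]
        omega
    _ = (x + 1) ^ Fintype.card α := by simp [add_pow]
    _ ≤ Real.exp x ^ Fintype.card α := by
        gcongr
        exact Real.add_one_le_exp x
    _ = Real.exp (x * Fintype.card α) := by rw [← Real.exp_nat_mul, mul_comm]

/-- Pulling a set family back along a map does not increase its VC dimension. -/
lemma vcDim_image_preimage_le {α β : Type*} [DecidableEq α] [Fintype β] [DecidableEq β]
    (φ : β → α) (𝒜 : Finset (Finset α)) :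
    (𝒜.image fun A => ({b | φ b ∈ A} : Finset β)).vcDim ≤ 𝒜.vcDim := by
  refine Finset.sup_le fun s hs => ?_
  rw [mem_shatterer] at hs
  have hinj : Set.InjOn φ s := by
    intro a ha b hb hab
    obtain ⟨u, hu, hsu⟩ := hs.exists_inter_eq_singleton ha
    obtain ⟨A, -, rfl⟩ := mem_image.1 hu
    have h1 : a ∈ s ∩ ({b | φ b ∈ A} : Finset β) := by simp [hsu]
    have h2 : b ∈ s ∩ ({b | φ b ∈ A} : Finset β) := by
      simp only [mem_inter, mem_filter, mem_univ, true_and] at h1 ⊢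
      exact ⟨hb, hab ▸ h1.2⟩
    rw [hsu, mem_singleton] at h2
    exact h2.symm
  rw [← card_image_of_injOn hinj]
  refine Shatters.card_le_vcDim fun t ht => ?_
  obtain ⟨u, hu, hsu⟩ := hs (filter_subset (fun b => φ b ∈ t) s)
  obtain ⟨A, hA, rfl⟩ := mem_image.1 hu
  refine ⟨A, hA, ?_⟩
  ext a
  simp only [Finset.ext_iff, mem_inter, mem_filter, mem_univ, true_and] at hsu
  simp only [mem_inter, mem_image]
  constructor
  · rintro ⟨⟨b, hb, rfl⟩, hbA⟩
    exact ((hsu b).1 ⟨hb, hbA⟩).2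
  · intro hat
    obtain ⟨b, hb, rfl⟩ := mem_image.1 (ht hat)
    exact ⟨⟨b, hb, rfl⟩, ((hsu b).2 ⟨hb, hat⟩).2⟩

/-- Sampling enough points separates all members of a family of pairwise distant sets. -/
lemma exists_separating_sample {ι : Type*} [Fintype ι] [Nonempty ι] [DecidableEq ι]
    {𝒜 : Finset (Finset ι)} {ρ : ℝ} (h𝒜 : 𝒜.Nonempty)
    (hsep : ∀ A ∈ 𝒜, ∀ B ∈ 𝒜, A ≠ B → ρ * Fintype.card ι ≤ #(A ∆ B))
    {m : ℕ} (hm : 2 * Real.log #𝒜 ≤ ρ * m) :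
    ∃ φ : Fin m → ι, Set.InjOn (fun A : Finset ι => ({l | φ l ∈ A} : Finset (Fin m))) 𝒜 := by
  by_contra! hcon
  set n := Fintype.card ι with hn
  have hn0 : (0 : ℝ) < n := by exact_mod_cast Fintype.card_pos
  have hN : (1 : ℝ) ≤ #𝒜 := by exact_mod_cast h𝒜.card_pos
  have hcover : (univ : Finset (Fin m → ι)) ⊆
      𝒜.offDiag.biUnion fun p => Fintype.piFinset fun _ => (p.1 ∆ p.2)ᶜ := by
    intro φ _
    have := hcon φ
    simp only [Set.InjOn, not_forall] at this
    obtain ⟨A, hA, B, hB, hAB, hne⟩ := this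
    refine mem_biUnion.2 ⟨(A, B), mem_offDiag.2 ⟨hA, hB, hne⟩, ?_⟩
    rw [Fintype.mem_piFinset]
    intro l
    have hl := congrArg (l ∈ ·) hAB
    simp only [mem_filter, mem_univ, true_and, eq_iff_iff] at hl
    simp only [mem_compl, mem_symmDiff]
    tauto
  have hcount := (card_le_card hcover).trans card_biUnion_le
  have hpair : ∀ p ∈ 𝒜.offDiag,
      ((#(Fintype.piFinset fun _ : Fin m => (p.1 ∆ p.2)ᶜ) : ℕ) : ℝ) ≤
        (n : ℝ) ^ m * ((#𝒜 : ℝ) ^ 2)⁻¹ := by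
    intro p hp
    obtain ⟨h1, h2, h3⟩ := mem_offDiag.1 hp
    have hs := hsep _ h1 _ h2 h3
    rw [Fintype.card_piFinset_const, card_compl, Nat.cast_pow, Nat.cast_sub (card_le_univ _)]
    have hle : (n : ℝ) - #(p.1 ∆ p.2) ≤ n * Real.exp (-ρ) := by
      have := Real.add_one_le_exp (-ρ)
      nlinarith
    have hnn : (0 : ℝ) ≤ (n : ℝ) - #(p.1 ∆ p.2) :=
      sub_nonneg.2 (by exact_mod_cast card_le_univ _)
    calc ((n : ℝ) - #(p.1 ∆ p.2)) ^ m ≤ (n * Real.exp (-ρ)) ^ m := by gcongr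
      _ = (n : ℝ) ^ m * Real.exp (-(ρ * m)) := by
        rw [mul_pow, ← Real.exp_nat_mul]; ring_nf
      _ ≤ (n : ℝ) ^ m * Real.exp (-(2 * Real.log #𝒜)) := by gcongr
      _ = (n : ℝ) ^ m * ((#𝒜 : ℝ) ^ 2)⁻¹ := by
        rw [Real.exp_neg, two_mul, Real.exp_add, Real.exp_log (by linarith), sq]
  have hcountR : (n : ℝ) ^ m ≤ #𝒜.offDiag * ((n : ℝ) ^ m * ((#𝒜 : ℝ) ^ 2)⁻¹) := by
    have h1 : (n : ℝ) ^ m ≤ ∑ p ∈ 𝒜.offDiag,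
        ((#(Fintype.piFinset fun _ : Fin m => (p.1 ∆ p.2)ᶜ) : ℕ) : ℝ) := by
      have := hcount
      rw [card_univ, Fintype.card_fun, Fintype.card_fin, ← hn] at this
      exact_mod_cast this
    refine h1.trans ((sum_le_sum hpair).trans ?_)
    rw [sum_const, nsmul_eq_mul]
  have hoff : (#𝒜.offDiag : ℝ) = #𝒜 * #𝒜 - #𝒜 := by
    rw [offDiag_card, Nat.cast_sub (Nat.le_mul_self _)]; push_cast; ring
  have hpos : (0 : ℝ) < (n : ℝ) ^ m := by positivity
  rw [hoff, mul_left_comm] at hcountR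
  have h2 : (1 : ℝ) ≤ (#𝒜 * #𝒜 - #𝒜) * ((#𝒜 : ℝ) ^ 2)⁻¹ := by
    by_contra! hlt
    nlinarith
  rw [← div_eq_mul_inv, le_div_iff₀ (by positivity)] at h2
  nlinarith

/-- Dudley's packing bound for set families of finite VC dimension. -/
lemma log_card_le_of_separated {ι : Type*} [Fintype ι] [Nonempty ι] [DecidableEq ι]
    {𝒜 : Finset (Finset ι)} {V : ℕ} (hV : 𝒜.vcDim ≤ V) {ρ : ℝ} (hρ : 0 < ρ) (hρ1 : ρ ≤ 1)
    (hsep : ∀ A ∈ 𝒜, ∀ B ∈ 𝒜, A ≠ B → ρ * Fintype.card ι ≤ #(A ∆ B)) :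
    Real.log #𝒜 ≤ 2 * V * Real.log (4 / ρ) + 1 / 2 := by
  have hlog : 0 ≤ Real.log (4 / ρ) :=
    Real.log_nonneg (by rw [le_div_iff₀ hρ]; linarith)
  rcases 𝒜.eq_empty_or_nonempty with rfl | hne
  · simp only [card_empty, Nat.cast_zero, Real.log_zero]
    positivity
  have hN : (1 : ℝ) ≤ #𝒜 := by exact_mod_cast hne.card_pos
  have hL : 0 ≤ Real.log #𝒜 := Real.log_nonneg hN
  set m := ⌈2 * Real.log #𝒜 / ρ⌉₊
  have hm1 : 2 * Real.log #𝒜 ≤ ρ * m := by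
    have := Nat.le_ceil (2 * Real.log #𝒜 / ρ)
    rwa [div_le_iff₀' hρ] at this
  have hm2 : ρ * m ≤ 2 * Real.log #𝒜 + ρ := by
    have := (Nat.ceil_lt_add_one (a := 2 * Real.log #𝒜 / ρ) (by positivity)).le
    calc ρ * m ≤ ρ * (2 * Real.log #𝒜 / ρ + 1) := by gcongr
      _ = _ := by field_simp
  obtain ⟨φ, hφ⟩ := exists_separating_sample hne hsep hm1
  have hb := card_mul_pow_le_exp ((vcDim_image_preimage_le φ 𝒜).trans hV)
    (x := ρ / 4) (by positivity) (by linarith)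
  rw [card_image_of_injOn hφ, Fintype.card_fin] at hb
  have := Real.log_le_log (by positivity) hb
  rw [Real.log_exp, Real.log_mul (by positivity) (by positivity), Real.log_pow] at this
  have hinv : Real.log (ρ / 4) = - Real.log (4 / ρ) := by rw [← Real.log_inv, inv_div]
  rw [hinv] at this
  nlinarith

/-- A maximal separated subfamily is a net. -/
lemma exists_separated_net {ι : Type*} [DecidableEq ι] (𝒜 : Finset (Finset ι)) (r : ℝ) :
    ∃ 𝒩 ⊆ 𝒜, (∀ A ∈ 𝒩, ∀ B ∈ 𝒩, A ≠ B → r < #(A ∆ B)) ∧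
      ∀ A ∈ 𝒜, ∃ B ∈ 𝒩, A = B ∨ (#(A ∆ B) : ℝ) ≤ r := by
  classical
  let S := 𝒜.powerset.filter fun 𝒩 => ∀ A ∈ 𝒩, ∀ B ∈ 𝒩, A ≠ B → r < #(A ∆ B)
  obtain ⟨𝒩, h𝒩⟩ := S.exists_maximal ⟨∅, by simp [S]⟩
  obtain ⟨hsub, hsep⟩ := mem_filter.1 h𝒩.prop
  refine ⟨𝒩, mem_powerset.1 hsub, hsep, fun A hA => ?_⟩
  by_contra! hcon
  have hins : insert A 𝒩 ∈ S := by
    refine mem_filter.2 ⟨mem_powerset.2 (insert_subset hA (mem_powerset.1 hsub)), ?_⟩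
    intro B hB D hD hne
    rcases mem_insert.1 hB with rfl | hB' <;> rcases mem_insert.1 hD with rfl | hD'
    · exact absurd rfl hne
    · exact (hcon _ hD').2
    · rw [symmDiff_comm]; exact (hcon _ hB').2
    · exact hsep _ hB' _ hD' hne
  exact (hcon A (h𝒩.le_of_ge hins (subset_insert _ _) (mem_insert_self _ _))).1 rfl

end Packing

section Rademacher

open Finset
open scoped symmDiff

/-- The sign `1` or `-1` encoded by a Boolean. -/
def boolSign (b : Bool) : ℝ := if b then 1 else -1

/-- `B` bounds the Rademacher average of the family of vectors `v a`, `a ∈ S`: however a member of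
`S` is selected from the signs `σ`, the average of the signed sums is at most `B`. -/
def RademacherLE {ι T : Type*} [Fintype ι] [DecidableEq ι] (v : T → ι → ℝ) (S : Set T) (B : ℝ) :
    Prop :=
  ∀ h : (ι → Bool) → T, (∀ σ, h σ ∈ S) →
    ∑ σ, ∑ i, boolSign (σ i) * v (h σ) i ≤ 2 ^ Fintype.card ι * B

variable {ι : Type*} [Fintype ι] [DecidableEq ι]

lemma sum_exp_sum_boolSign_le (v : ι → ℝ) (c : ℝ) :
    ∑ σ : ι → Bool, Real.exp (c * ∑ i, boolSign (σ i) * v i) ≤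
      2 ^ Fintype.card ι * Real.exp (c ^ 2 * (∑ i, v i ^ 2) / 2) := by
  have h1 : ∀ σ : ι → Bool, Real.exp (c * ∑ i, boolSign (σ i) * v i) =
      ∏ i, Real.exp (c * (boolSign (σ i) * v i)) := fun σ => by
    rw [mul_sum, Real.exp_sum]
  have h2 := (prod_univ_sum (fun _ : ι => (univ : Finset Bool))
    fun i b => Real.exp (c * (boolSign b * v i))).symm
  rw [Fintype.piFinset_univ] at h2
  simp_rw [h1]
  rw [h2]
  calc ∏ i, ∑ b, Real.exp (c * (boolSign b * v i))
      ≤ ∏ i, 2 * Real.exp ((c * v i) ^ 2 / 2) := by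
        refine prod_le_prod (fun _ _ => by positivity) fun i _ => ?_
        have := Real.cosh_le_exp_half_sq (c * v i)
        rw [Real.cosh_eq] at this
        simp only [Fintype.sum_bool, boolSign, if_true, Bool.false_eq_true, if_false, one_mul,
          neg_mul, mul_neg]
        linarith
    _ = 2 ^ Fintype.card ι * Real.exp (c ^ 2 * (∑ i, v i ^ 2) / 2) := by
        rw [prod_mul_distrib, prod_const, card_univ, ← Real.exp_sum]
        congr 2
        rw [mul_sum, sum_div]
        exact sum_congr rfl fun i _ => by ring

lemma sum_boolSign (i : ι) : ∑ σ : ι → Bool, boolSign (σ i) = 0 := by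
  let e : (ι → Bool) ≃ (ι → Bool) := Equiv.arrowCongr (Equiv.refl ι) Equiv.boolNot
  have h : ∑ σ : ι → Bool, boolSign (e σ i) = ∑ σ : ι → Bool, boolSign (σ i) :=
    e.sum_comp fun σ => boolSign (σ i)
  have h' : ∀ σ : ι → Bool, boolSign (e σ i) = - boolSign (σ i) := fun σ => by
    cases hσ : σ i <;> simp [e, boolSign, hσ]
  simp_rw [h', sum_neg_distrib] at h
  linarith

lemma rademacherLE_of_subsingleton {T : Type*} (v : T → ι → ℝ) {S : Set T} (hS : S.Subsingleton)
    {B : ℝ} (hB : 0 ≤ B) : RademacherLE v S B := by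
  intro h hh
  have hc : ∀ σ, h σ = h fun _ => true := fun σ => hS (hh _) (hh _)
  have h0 : ∑ σ, ∑ i, boolSign (σ i) * v (h σ) i = 0 := by
    simp_rw [hc]
    rw [sum_comm]
    simp_rw [← sum_mul, sum_boolSign, zero_mul, sum_const_zero]
  rw [h0]
  positivity

lemma RademacherLE.mono {T : Type*} {v : T → ι → ℝ} {S : Set T} {B B' : ℝ}
    (h : RademacherLE v S B) (hB : B ≤ B') : RademacherLE v S B' := fun s hs =>
  (h s hs).trans (by gcongr)

lemma RademacherLE.neg {T : Type*} {v : T → ι → ℝ} {S : Set T} {B : ℝ}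
    (hv : RademacherLE v S B) : RademacherLE (fun a i => -v a i) S B := by
  intro h hh
  let e : (ι → Bool) ≃ (ι → Bool) := Equiv.arrowCongr (Equiv.refl ι) Equiv.boolNot
  rw [← e.sum_comp]
  have h' : ∀ (σ : ι → Bool) i, boolSign (e σ i) = - boolSign (σ i) := fun σ i => by
    cases hσ : σ i <;> simp [e, boolSign, hσ]
  simp_rw [h', neg_mul_neg]
  exact hv (fun σ => h (e σ)) fun σ => hh _

/-- Massart's finite class lemma. -/
lemma rademacherLE_sqrt {T : Type*} (S : Finset T) (v : T → ι → ℝ) {r L : ℝ} (hr : 0 < r)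
    (hL : 0 < L) (hv : ∀ a ∈ S, ∑ i, v a i ^ 2 ≤ r) (hS : Real.log #S ≤ L) :
    RademacherLE v S √(2 * r * L) := by
  intro h hh
  have hne : S.Nonempty := ⟨_, hh fun _ => true⟩
  have hN : (0 : ℝ) < #S := by exact_mod_cast hne.card_pos
  set c := √(2 * r * L) / r with hc
  have hcpos : 0 < c := by positivity
  have hc2 : c ^ 2 * r / 2 = L := by
    rw [hc, div_pow, Real.sq_sqrt (by positivity)]
    field_simp
  have hcr : c * √(2 * r * L) = 2 * L := by
    rw [hc, div_mul_eq_mul_div, Real.mul_self_sqrt (by positivity)]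
    field_simp
  set Z : (ι → Bool) → T → ℝ := fun σ a => ∑ i, boolSign (σ i) * v a i
  set M := (#S : ℝ) * Real.exp L with hM
  have hMpos : 0 < M := by positivity
  have hlogM : Real.log M = Real.log #S + L := by
    rw [hM, Real.log_mul hN.ne' (Real.exp_pos _).ne', Real.log_exp]
  have htangent : ∀ σ, c * Z σ (h σ) ≤ Real.log M - 1 + Real.exp (c * Z σ (h σ)) / M := by
    intro σ
    have := Real.add_one_le_exp (c * Z σ (h σ) - Real.log M)
    rw [Real.exp_sub, Real.exp_log hMpos] at this
    linarith
  have hexp : ∑ σ, Real.exp (c * Z σ (h σ)) ≤ 2 ^ Fintype.card ι * M := by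
    calc ∑ σ, Real.exp (c * Z σ (h σ)) ≤ ∑ σ, ∑ a ∈ S, Real.exp (c * Z σ a) :=
          sum_le_sum fun σ _ => single_le_sum (f := fun a => Real.exp (c * Z σ a))
            (fun a _ => (Real.exp_pos _).le) (hh σ)
      _ = ∑ a ∈ S, ∑ σ, Real.exp (c * Z σ a) := sum_comm
      _ ≤ ∑ a ∈ S, 2 ^ Fintype.card ι * Real.exp L := by
          refine sum_le_sum fun a ha => (sum_exp_sum_boolSign_le (v a) c).trans ?_
          rw [← hc2]
          gcongr
          exact hv a ha
      _ = 2 ^ Fintype.card ι * M := by rw [sum_const, nsmul_eq_mul, hM]; ring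
  have hsum := sum_le_sum fun σ (_ : σ ∈ (univ : Finset (ι → Bool))) => htangent σ
  rw [← mul_sum, sum_add_distrib, ← sum_div, sum_const, card_univ, Fintype.card_fun,
    Fintype.card_bool, nsmul_eq_mul] at hsum
  push_cast at hsum
  have hdiv : (∑ σ, Real.exp (c * Z σ (h σ))) / M ≤ 2 ^ Fintype.card ι := by
    rwa [div_le_iff₀ hMpos]
  have hfin : c * ∑ σ, Z σ (h σ) ≤ c * (2 ^ Fintype.card ι * √(2 * r * L)) := by
    have h2 : c * (2 ^ Fintype.card ι * √(2 * r * L)) = 2 ^ Fintype.card ι * (2 * L) := by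
      rw [← hcr]; ring
    rw [h2]
    have h3 : (2 : ℝ) ^ Fintype.card ι * (Real.log M - 1) ≤
        2 ^ Fintype.card ι * (2 * L - 1) := by
      gcongr
      rw [hlogM]
      linarith
    linarith
  exact le_of_mul_le_mul_left hfin hcpos

/-- The indicator vector of a finite set. -/
def indicatorVec {α : Type*} [DecidableEq α] (A : Finset α) (i : α) : ℝ := if i ∈ A then 1 else 0

lemma sq_indicatorVec_sub {α : Type*} [DecidableEq α] (A B : Finset α) (i : α) :
    (indicatorVec A i - indicatorVec B i) ^ 2 = if i ∈ A ∆ B then 1 else 0 := by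
  by_cases hA : i ∈ A <;> by_cases hB : i ∈ B <;> simp [indicatorVec, mem_symmDiff, hA, hB]

/-- The chaining bound: the Rademacher average of a set family of finite VC dimension. -/
lemma rademacherLE_indicatorVec {𝒜 : Finset (Finset ι)} {V : ℕ} (hV : 𝒜.vcDim ≤ V) :
    RademacherLE indicatorVec (𝒜 : Set (Finset ι)) (16 * √(V * Fintype.card ι)) := by
  rcases Nat.eq_zero_or_pos V with rfl | hVpos
  · refine rademacherLE_of_subsingleton _ ?_ (by positivity)
    have hcard := 𝒜.card_le_card_shatterer.trans card_shatterer_le_sum_vcDim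
    rw [Nat.le_zero.1 hV] at hcard
    have : #𝒜 ≤ 1 := by simpa [← Nat.range_succ_eq_Iic] using hcard
    exact fun A hA B hB => card_le_one.1 this A hA B hB
  rcases isEmpty_or_nonempty ι with hι | hι
  · exact rademacherLE_of_subsingleton _ (fun A _ B _ => Subsingleton.elim A B) (by positivity)
  set n := Fintype.card ι with hn
  have hn0 : (0 : ℝ) < n := by exact_mod_cast Fintype.card_pos
  have hV1 : (1 : ℝ) ≤ V := by exact_mod_cast hVpos
  choose 𝒩 hsub hsep hnet using fun j : ℕ => exists_separated_net 𝒜 ((1 / 4 : ℝ) ^ j * n)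
  have hlink : ∀ j, ∀ A ∈ 𝒜, ∃ B ∈ 𝒩 j, (#(A ∆ B) : ℝ) ≤ (1 / 4 : ℝ) ^ j * n := by
    intro j A hA
    obtain ⟨B, hB, rfl | h⟩ := hnet j A hA
    · exact ⟨A, hB, by
        simp only [symmDiff_self, bot_eq_empty, card_empty, Nat.cast_zero]
        positivity⟩
    · exact ⟨B, hB, h⟩
  choose! π hπ hπd using hlink
  have hchain : ∀ j, RademacherLE indicatorVec (𝒩 j : Set (Finset ι))
      (4 * √(V * n) * ∑ k ∈ range j, (3 / 4 : ℝ) ^ k) := by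
    intro j
    induction j with
    | zero =>
      refine rademacherLE_of_subsingleton _ (fun A hA B hB => ?_) (by simp)
      by_contra hne
      have h1 := hsep 0 A hA B hB hne
      have h2 : (#(A ∆ B) : ℝ) ≤ n := by exact_mod_cast card_le_univ _
      simp only [pow_zero, one_mul] at h1
      linarith
    | succ j ih =>
      intro h hh
      have hlog : Real.log #(𝒩 (j + 1)) ≤ 4 * V * (j + 2) := by
        have hdim : (𝒩 (j + 1)).vcDim ≤ V := (vcDim_mono (hsub (j + 1))).trans hV
        have := log_card_le_of_separated hdim (ρ := (1 / 4 : ℝ) ^ (j + 1)) (by positivity)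
          (pow_le_one₀ (by norm_num) (by norm_num))
          fun A hA B hB hne => (hsep (j + 1) A hA B hB hne).le
        have hl : Real.log (4 / (1 / 4 : ℝ) ^ (j + 1)) = (j + 2) * (2 * Real.log 2) := by
          have : (4 / (1 / 4 : ℝ) ^ (j + 1)) = 2 ^ (2 * (j + 2)) := by
            rw [pow_mul, one_div, inv_pow, div_inv_eq_mul]; ring
          rw [this, Real.log_pow]; push_cast; ring
        rw [hl] at this
        have h2 := Real.log_two_lt_d9
        have hj : (0 : ℝ) ≤ j := j.cast_nonneg
        have h3 : (V : ℝ) * ((j + 2) * (2 * Real.log 2)) ≤ V * ((j + 2) * 1.5) := by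
          gcongr; linarith
        nlinarith
      have hmass := rademacherLE_sqrt (𝒩 (j + 1))
        (fun A i => indicatorVec A i - indicatorVec (π j A) i)
        (r := (1 / 4 : ℝ) ^ j * n) (L := 4 * V * (j + 2)) (by positivity) (by positivity)
        (fun A hA => by
          simp_rw [sq_indicatorVec_sub]
          rw [sum_boole]
          simpa using hπd j A (hsub _ hA)) hlog
      have hsqrt : √(2 * ((1 / 4 : ℝ) ^ j * n) * (4 * V * (j + 2))) ≤
          4 * √(V * n) * (3 / 4 : ℝ) ^ j := by
        rw [Real.sqrt_le_left (by positivity), mul_pow, mul_pow, Real.sq_sqrt (by positivity)]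
        have hb := one_add_mul_le_pow (a := (5 / 4 : ℝ)) (by norm_num) j
        have hj : (0 : ℝ) ≤ j := j.cast_nonneg
        have h94 : ((j : ℝ) + 2) ≤ 2 * (9 / 4 : ℝ) ^ j := by
          have : (1 + 5 / 4 : ℝ) = 9 / 4 := by norm_num
          rw [this] at hb
          linarith
        have h34 : ((3 / 4 : ℝ) ^ j) ^ 2 = (1 / 4 : ℝ) ^ j * (9 / 4) ^ j := by
          rw [← pow_mul, mul_comm, pow_mul, ← mul_pow]; norm_num
        rw [h34]
        calc 2 * ((1 / 4 : ℝ) ^ j * n) * (4 * V * (j + 2))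
            ≤ 2 * ((1 / 4 : ℝ) ^ j * n) * (4 * V * (2 * (9 / 4 : ℝ) ^ j)) := by gcongr
          _ = _ := by ring
      have h1 := ih (fun σ => π j (h σ)) fun σ => hπ j _ (hsub _ (hh σ))
      have h2 := hmass.mono hsqrt h hh
      have hsplit : ∑ σ, ∑ i, boolSign (σ i) * indicatorVec (h σ) i =
          (∑ σ, ∑ i, boolSign (σ i) * indicatorVec (π j (h σ)) i) +
          ∑ σ, ∑ i, boolSign (σ i) * (indicatorVec (h σ) i - indicatorVec (π j (h σ)) i) := by
        simp_rw [← sum_add_distrib]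
        exact sum_congr rfl fun σ _ => sum_congr rfl fun i _ => by ring
      rw [hsplit, sum_range_succ, mul_add, mul_add]
      exact add_le_add h1 h2
  obtain ⟨J, hJ⟩ := exists_pow_lt_of_lt_one (show (0 : ℝ) < 1 / n by positivity)
    (show (1 / 4 : ℝ) < 1 by norm_num)
  have hall : 𝒜 ⊆ 𝒩 J := by
    intro A hA
    have h1 := hπd J A hA
    rw [lt_div_iff₀ hn0] at hJ
    have h2 : #(A ∆ π J A) < 1 := by exact_mod_cast h1.trans_lt hJ
    have h3 : A ∆ π J A = ∅ := card_eq_zero.1 (by omega)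
    have h4 : A = π J A := symmDiff_eq_bot.1 h3
    rw [h4]
    exact hπ J A hA
  have hgeom : ∑ k ∈ range J, (3 / 4 : ℝ) ^ k ≤ 4 := by
    rw [geom_sum_eq (by norm_num)]
    have h0 : (0 : ℝ) ≤ (3 / 4 : ℝ) ^ J := by positivity
    have h1 : ((3 / 4 : ℝ) ^ J - 1) / (3 / 4 - 1) = 4 * (1 - (3 / 4 : ℝ) ^ J) := by ring
    linarith
  have hfin : 4 * √(V * n) * ∑ k ∈ range J, (3 / 4 : ℝ) ^ k ≤ 16 * √(V * n) := by
    have : (0 : ℝ) ≤ √(V * n) := Real.sqrt_nonneg _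
    nlinarith
  exact fun h hh => (hchain J).mono hfin h fun σ => hall (hh σ)

end Rademacher

section BoundedDifferences

variable {X : Type*} [MeasurableSpace X]

lemma integrable_of_abs_le {ν : Measure X} [IsFiniteMeasure ν] {f : X → ℝ} (hf : Measurable f)
    {M : ℝ} (hM : ∀ x, |f x| ≤ M) : Integrable f ν :=
  Integrable.of_bound hf.aestronglyMeasurable M (ae_of_all _ hM)

lemma abs_integral_le_of_abs_le {ν : Measure X} [IsProbabilityMeasure ν] {f : X → ℝ} {M : ℝ}
    (hM : ∀ x, |f x| ≤ M) : |∫ x, f x ∂ν| ≤ M := by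
  have := norm_integral_le_of_norm_le_const (μ := ν) (f := f) (ae_of_all _ hM)
  simpa using this

lemma abs_exp_mul_le {u M : ℝ} (t : ℝ) (hu : |u| ≤ M) :
    |Real.exp (t * u)| ≤ Real.exp (|t| * M) := by
  rw [abs_of_pos (Real.exp_pos _)]
  refine Real.exp_le_exp.2 ?_
  calc t * u ≤ |t * u| := le_abs_self _
    _ = |t| * |u| := abs_mul _ _
    _ ≤ |t| * M := by gcongr

/-- Hoeffding's lemma for a function of oscillation at most `c`. -/
lemma integral_exp_mul_le_of_sub_le (ν : Measure X) [IsProbabilityMeasure ν] {h : X → ℝ}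
    (hh : Measurable h) {M c : ℝ} (hM : ∀ x, |h x| ≤ M) (hc : ∀ x y, h x - h y ≤ c) (t : ℝ) :
    ∫ x, Real.exp (t * h x) ∂ν ≤ Real.exp (t * ∫ x, h x ∂ν + t ^ 2 * c ^ 2 / 8) := by
  have hne : Nonempty X := nonempty_of_isProbabilityMeasure ν
  have hc0 : 0 ≤ c := by simpa using hc hne.some hne.some
  have hbdd : BddBelow (Set.range h) := ⟨-M, by rintro _ ⟨x, rfl⟩; exact neg_le_of_abs_le (hM x)⟩
  have hmem : ∀ x, h x ∈ Set.Icc (⨅ y, h y) ((⨅ y, h y) + c) := fun x => by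
    refine ⟨ciInf_le hbdd x, ?_⟩
    have : h x - c ≤ ⨅ y, h y := le_ciInf fun y => by linarith [hc x y]
    linarith
  have hmgf := (hasSubgaussianMGF_of_mem_Icc (μ := ν) hh.aemeasurable (ae_of_all _ hmem)).mgf_le t
  have hparam : ((((‖(⨅ y, h y) + c - ⨅ y, h y‖₊ / 2) ^ 2 : NNReal) : ℝ)) = c ^ 2 / 4 := by
    push_cast
    rw [add_sub_cancel_left, Real.norm_of_nonneg hc0]
    ring
  rw [hparam, mgf] at hmgf
  have heq : ∀ x, Real.exp (t * h x) =
      Real.exp (t * ∫ x, h x ∂ν) * Real.exp (t * (h x - ∫ x, h x ∂ν)) := fun x => by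
    rw [← Real.exp_add]; ring_nf
  simp_rw [heq]
  rw [integral_const_mul, Real.exp_add]
  gcongr
  exact hmgf.trans_eq (by ring_nf)

lemma measurable_finCons {n : ℕ} :
    Measurable fun p : X × (Fin n → X) => (Fin.cons p.1 p.2 : Fin (n + 1) → X) := by
  refine measurable_pi_lambda _ fun i => ?_
  refine Fin.cases ?_ (fun j => ?_) i
  · simpa using measurable_fst
  · simpa using! (measurable_pi_apply j).comp measurable_snd

lemma integral_pi_succ (ν : Measure X) [IsProbabilityMeasure ν] {n : ℕ}
    {F : (Fin (n + 1) → X) → ℝ} (hF : Measurable F) {M : ℝ} (hM : ∀ x, |F x| ≤ M) :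
    ∫ x, F x ∂(Measure.pi fun _ => ν) =
      ∫ a, ∫ y, F (Fin.cons a y) ∂(Measure.pi fun _ : Fin n => ν) ∂ν := by
  have hmp := (measurePreserving_piFinSuccAbove (fun _ : Fin (n + 1) => ν) 0).symm
  have hcons : ∀ p, (MeasurableEquiv.piFinSuccAbove (fun _ : Fin (n + 1) => X) 0).symm p =
      Fin.cons p.1 p.2 := fun p => by
    simp [MeasurableEquiv.piFinSuccAbove_symm_apply, Fin.insertNthEquiv]
  rw [← hmp.integral_comp']
  simp_rw [hcons]
  exact integral_prod _ (integrable_of_abs_le (hF.comp measurable_finCons) fun p => hM _)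

/-- McDiarmid's inequality, for the moment generating function. -/
lemma integral_exp_mul_le_of_update_sub_le (ν : Measure X) [IsProbabilityMeasure ν] {M c : ℝ}
    (t : ℝ) (n : ℕ) {g : (Fin n → X) → ℝ} (hg : Measurable g) (hM : ∀ x, |g x| ≤ M)
    (hc : ∀ x i y, g (Function.update x i y) - g x ≤ c) :
    ∫ x, Real.exp (t * g x) ∂(Measure.pi fun _ => ν) ≤
      Real.exp (t * ∫ x, g x ∂(Measure.pi fun _ => ν) + n * (t ^ 2 * c ^ 2 / 8)) := by
  induction n with
  | zero =>
    have hx : ∀ x, g x = g default := fun x => congrArg g (Subsingleton.elim _ _)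
    simp_rw [hx]
    simp
  | succ n ih =>
    have hexpM : ∀ x, |Real.exp (t * g x)| ≤ Real.exp (|t| * M) :=
      fun x => abs_exp_mul_le t (hM x)
    have hgm : Measurable fun p : X × (Fin n → X) => g (Fin.cons p.1 p.2) :=
      hg.comp measurable_finCons
    have hgi : ∀ a, Integrable (fun y => g (Fin.cons a y)) (Measure.pi fun _ : Fin n => ν) :=
      fun a => integrable_of_abs_le (hgm.comp measurable_prodMk_left) fun y => hM _
    set h : X → ℝ := fun a => ∫ y, g (Fin.cons a y) ∂(Measure.pi fun _ : Fin n => ν)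
    have hhm : Measurable h :=
      (hgm.stronglyMeasurable.integral_prod_right (ν := Measure.pi fun _ : Fin n => ν)).measurable
    have hhM : ∀ a, |h a| ≤ M := fun a => abs_integral_le_of_abs_le fun y => hM _
    have hhc : ∀ a b, h a - h b ≤ c := fun a b => by
      rw [← integral_sub (hgi a) (hgi b)]
      have hle : ∀ y : Fin n → X, g (Fin.cons a y) - g (Fin.cons b y) ≤ c := fun y => by
        have := hc (Fin.cons b y) 0 a
        rwa [Fin.update_cons_zero] at this
      calc ∫ y, (g (Fin.cons a y) - g (Fin.cons b y)) ∂(Measure.pi fun _ : Fin n => ν)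
          ≤ ∫ _, c ∂(Measure.pi fun _ : Fin n => ν) :=
            integral_mono ((hgi a).sub (hgi b)) (integrable_const c) hle
        _ = c := by simp
    have hstep : ∀ a, ∫ y, Real.exp (t * g (Fin.cons a y)) ∂(Measure.pi fun _ : Fin n => ν) ≤
        Real.exp (n * (t ^ 2 * c ^ 2 / 8)) * Real.exp (t * h a) := fun a => by
      rw [← Real.exp_add, add_comm (_ * _) (t * h a)]
      refine ih (hgm.comp measurable_prodMk_left) (fun y => hM _) fun x i y => ?_
      rw [Fin.cons_update]
      exact hc _ _ _
    have hint : ∫ x, g x ∂(Measure.pi fun _ : Fin (n + 1) => ν) = ∫ a, h a ∂ν :=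
      integral_pi_succ ν hg hM
    rw [integral_pi_succ ν ((hg.const_mul t).exp) hexpM, hint]
    have hexph : Integrable (fun a => Real.exp (t * h a)) ν :=
      integrable_of_abs_le ((hhm.const_mul t).exp) fun a => abs_exp_mul_le t (hhM a)
    have hmeas : Measurable fun a => ∫ y, Real.exp (t * g (Fin.cons a y))
        ∂(Measure.pi fun _ : Fin n => ν) :=
      (((hgm.const_mul t).exp).stronglyMeasurable.integral_prod_right
        (ν := Measure.pi fun _ : Fin n => ν)).measurable
    have hleft : Integrable (fun a => ∫ y, Real.exp (t * g (Fin.cons a y))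
        ∂(Measure.pi fun _ : Fin n => ν)) ν :=
      integrable_of_abs_le hmeas (M := Real.exp (|t| * M)) fun a =>
        abs_integral_le_of_abs_le fun y => hexpM _
    calc ∫ a, ∫ y, Real.exp (t * g (Fin.cons a y)) ∂(Measure.pi fun _ : Fin n => ν) ∂ν
        ≤ ∫ a, Real.exp (n * (t ^ 2 * c ^ 2 / 8)) * Real.exp (t * h a) ∂ν :=
          integral_mono hleft (hexph.const_mul _) hstep
      _ = Real.exp (n * (t ^ 2 * c ^ 2 / 8)) * ∫ a, Real.exp (t * h a) ∂ν :=
          integral_const_mul _ _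
      _ ≤ Real.exp (n * (t ^ 2 * c ^ 2 / 8)) *
            Real.exp (t * ∫ a, h a ∂ν + t ^ 2 * c ^ 2 / 8) := by
          gcongr
          exact integral_exp_mul_le_of_sub_le ν hhm hhM hhc t
      _ = _ := by
          rw [← Real.exp_add]
          push_cast
          ring_nf

/-- McDiarmid's inequality with equal oscillations in all coordinates. -/
lemma measureReal_add_sqrt_le_le (ν : Measure X) [IsProbabilityMeasure ν] {M c η : ℝ}
    (hc0 : 0 < c) (hη : 0 < η) (hη1 : η < 1) {n : ℕ} (hn : 0 < n) {g : (Fin n → X) → ℝ}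
    (hg : Measurable g) (hM : ∀ x, |g x| ≤ M)
    (hc : ∀ x i y, g (Function.update x i y) - g x ≤ c) :
    (Measure.pi fun _ => ν).real {x | ∫ z, g z ∂(Measure.pi fun _ => ν) +
      c * √(n * Real.log (1 / η) / 2) ≤ g x} ≤ η := by
  set P := Measure.pi fun _ : Fin n => ν
  set L := Real.log (1 / η) with hLdef
  have hn0 : (0 : ℝ) < n := by exact_mod_cast hn
  have hL : 0 < L := Real.log_pos (by rw [lt_div_iff₀ hη]; linarith)
  set s := √(n * L / 2) with hs
  have hs2 : s ^ 2 = n * L / 2 := Real.sq_sqrt (by positivity)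
  set t := 4 * s / (n * c) with ht
  have ht0 : 0 ≤ t := by positivity
  have hint : Integrable (fun x => Real.exp (t * g x)) P :=
    integrable_of_abs_le ((hg.const_mul t).exp) fun a => abs_exp_mul_le t (hM a)
  refine (measure_ge_le_exp_mul_mgf _ ht0 hint).trans ?_
  have hmgf := integral_exp_mul_le_of_update_sub_le ν t n hg hM hc
  calc Real.exp (-t * (∫ z, g z ∂P + c * s)) * mgf g P t
      ≤ Real.exp (-t * (∫ z, g z ∂P + c * s)) *
          Real.exp (t * ∫ x, g x ∂P + n * (t ^ 2 * c ^ 2 / 8)) := by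
        gcongr
        exact hmgf
    _ = Real.exp (-L) := by
        rw [← Real.exp_add]
        congr 1
        have h1 : t * (c * s) = 2 * L := by
          have : t * (c * s) = 4 * s ^ 2 / n := by rw [ht]; field_simp
          rw [this, hs2]; field_simp; ring
        have h2 : n * (t ^ 2 * c ^ 2 / 8) = L := by
          have : n * (t ^ 2 * c ^ 2 / 8) = 2 * s ^ 2 / n := by rw [ht]; field_simp; ring
          rw [this, hs2]; field_simp
        linear_combination -h1 + h2
    _ = η := by rw [hLdef, one_div, Real.log_inv, neg_neg, Real.exp_log hη]

end BoundedDifferences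

section Symmetrization

/-- A bound for all superlevel sets of a family of `[0, 1]`-valued vectors is a bound for the
vectors themselves. -/
lemma rademacherLE_of_superlevel {ι T : Type*} [Fintype ι] [DecidableEq ι] {v : T → ι → ℝ}
    {S : Set T} {B : ℝ} (hv : ∀ a i, v a i ∈ Set.Icc (0 : ℝ) 1)
    (h : ∀ t ∈ Set.Ioo (0 : ℝ) 1, RademacherLE (fun a i => if t < v a i then 1 else 0) S B) :
    RademacherLE v S B := by
  intro f hf
  set ν : Measure ℝ := volume.restrict (Set.Ioo 0 1)
  have hprob : IsProbabilityMeasure ν := ⟨by simp [ν]⟩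
  have hmeas : ∀ u : ℝ, Measurable fun t : ℝ => if t < u then (1 : ℝ) else 0 := fun u =>
    Measurable.ite measurableSet_Iio measurable_const measurable_const
  have hint : ∀ u : ℝ, Integrable (fun t : ℝ => if t < u then (1 : ℝ) else 0) ν := fun u =>
    integrable_of_abs_le (hmeas u) (M := 1) fun t => by split_ifs <;> simp
  have hval : ∀ u ∈ Set.Icc (0 : ℝ) 1, u = ∫ t, (if t < u then (1 : ℝ) else 0) ∂ν := by
    intro u hu
    have h1 : (fun t : ℝ => if t < u then (1 : ℝ) else 0) = (Set.Iio u).indicator 1 := by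
      ext t; simp [Set.indicator]
    have h2 : Set.Iio u ∩ Set.Ioo 0 1 = Set.Ioo 0 u := by
      ext t
      simp only [Set.mem_inter_iff, Set.mem_Iio, Set.mem_Ioo]
      exact ⟨fun h => ⟨h.2.1, h.1⟩, fun h => ⟨h.2, h.1, h.2.trans_le hu.2⟩⟩
    rw [h1, integral_indicator_one measurableSet_Iio, measureReal_restrict_apply measurableSet_Iio,
      h2, Real.volume_real_Ioo_of_le hu.1, sub_zero]
  have heq : ∑ σ, ∑ i, boolSign (σ i) * v (f σ) i =
      ∫ t, ∑ σ, ∑ i, boolSign (σ i) * (if t < v (f σ) i then 1 else 0) ∂ν := by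
    rw [integral_finsetSum _ fun σ _ => integrable_finsetSum _ fun i _ => (hint _).const_mul _]
    refine Finset.sum_congr rfl fun σ _ => ?_
    rw [integral_finsetSum _ fun i _ => (hint _).const_mul _]
    refine Finset.sum_congr rfl fun i _ => ?_
    rw [integral_const_mul, ← hval _ (hv _ _)]
  rw [heq]
  calc ∫ t, ∑ σ, ∑ i, boolSign (σ i) * (if t < v (f σ) i then 1 else 0) ∂ν
      ≤ ∫ _, 2 ^ Fintype.card ι * B ∂ν := by
        refine integral_mono_ae (integrable_finsetSum _ fun σ _ =>
          integrable_finsetSum _ fun i _ => (hint _).const_mul _) (integrable_const _) ?_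
        filter_upwards [ae_restrict_mem measurableSet_Ioo] with t ht
        exact h t ht f hf
    _ = 2 ^ Fintype.card ι * B := by simp

lemma measurable_finset_sup' {Y T : Type*} [MeasurableSpace Y] {S : Finset T} (hS : S.Nonempty)
    {u : T → Y → ℝ} (hu : ∀ a, Measurable (u a)) :
    Measurable fun y => S.sup' hS fun a => u a y := by
  convert Finset.measurable_sup' hS (f := u) fun a _ => hu a using 1
  ext y
  rw [Finset.sup'_apply]

lemma abs_finset_sup'_le {T : Type*} {S : Finset T} (hS : S.Nonempty) {u : T → ℝ} {K : ℝ}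
    (hu : ∀ a, |u a| ≤ K) : |S.sup' hS u| ≤ K := by
  obtain ⟨a, -, ha⟩ := Finset.exists_mem_eq_sup' hS u
  rw [ha]
  exact hu a

variable {X T : Type*} [MeasurableSpace X]

/-- The Rademacher bound controls the expected supremum of the centred sums. -/
lemma integral_sup'_sum_sub_le (ν : Measure X) [IsProbabilityMeasure ν] {n : ℕ} {S : Finset T}
    (hS : S.Nonempty) {g : T → X → ℝ} (hg : ∀ a, Measurable (g a)) {M B : ℝ}
    (hM : ∀ a x, |g a x| ≤ M)
    (hB : ∀ x : Fin n → X, RademacherLE (fun a i => g a (x i)) (S : Set T) B) :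
    ∫ x, S.sup' hS (fun a => ∑ i, (g a (x i) - ∫ z, g a z ∂ν)) ∂(Measure.pi fun _ : Fin n => ν) ≤
      2 * B := by
  classical
  set P := Measure.pi fun _ : Fin n => ν
  have hdiff : ∀ a x y, |g a x - g a y| ≤ 2 * M := fun a x y =>
    (abs_sub _ _).trans (by linarith [hM a x, hM a y])
  have hsum : ∀ (u : Fin n → ℝ), (∀ i, |u i| ≤ 2 * M) → |∑ i, u i| ≤ n * (2 * M) := fun u hu => by
    refine (Finset.abs_sum_le_sum_abs _ _).trans ((Finset.sum_le_sum fun i _ => hu i).trans ?_)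
    simp
  have hgi : ∀ a, Integrable (g a) ν := fun a => integrable_of_abs_le (hg a) (hM a)
  let D : (Fin n → X) × (Fin n → X) → ℝ := fun p =>
    S.sup' hS fun a => ∑ i, (g a (p.1 i) - g a (p.2 i))
  have hDm : Measurable D := by
    refine measurable_finset_sup' hS fun a => Finset.measurable_sum _ fun i _ => ?_
    exact ((hg a).comp ((measurable_pi_apply i).comp measurable_fst)).sub
      ((hg a).comp ((measurable_pi_apply i).comp measurable_snd))
  have hDb : ∀ p, |D p| ≤ n * (2 * M) := fun p => abs_finset_sup'_le hS fun a => hsum _ fun i => hdiff _ _ _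
  have hDint : Integrable D (P.prod P) := integrable_of_abs_le hDm hDb
  have hcenter : ∀ x, S.sup' hS (fun a => ∑ i, (g a (x i) - ∫ z, g a z ∂ν)) ≤
      ∫ y, D (x, y) ∂P := by
    intro x
    refine Finset.sup'_le _ _ fun a ha => ?_
    have hcoord : ∀ i, MeasurePreserving (fun y : Fin n → X => y i) P ν := fun i =>
      measurePreserving_eval (fun _ : Fin n => ν) i
    have hi : ∀ i, Integrable (fun y : Fin n → X => g a (x i) - g a (y i)) P := fun i =>
      (integrable_const _).sub ((hcoord i).integrable_comp_of_integrable (hgi a))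
    have heq : ∑ i, (g a (x i) - ∫ z, g a z ∂ν) = ∫ y, ∑ i, (g a (x i) - g a (y i)) ∂P := by
      rw [integral_finsetSum _ fun i _ => hi i]
      refine Finset.sum_congr rfl fun i _ => ?_
      rw [integral_sub (f := fun _ => g a (x i)) (g := fun y : Fin n → X => g a (y i))
        (integrable_const _) ((hcoord i).integrable_comp_of_integrable (hgi a))]
      have : ∫ y, g a (y i) ∂P = ∫ z, g a z ∂ν := by
        rw [← (hcoord i).map_eq, integral_map (hcoord i).aemeasurable (hg a).aestronglyMeasurable]
      rw [this]
      simp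
    rw [heq]
    exact integral_mono (integrable_finsetSum _ fun i _ => hi i)
      (integrable_of_abs_le (hDm.comp measurable_prodMk_left) fun y => hDb _)
      fun y => Finset.le_sup' (fun a => ∑ i, (g a (x i) - g a (y i))) ha
  have hstep1 : ∫ x, S.sup' hS (fun a => ∑ i, (g a (x i) - ∫ z, g a z ∂ν)) ∂P ≤
      ∫ p, D p ∂(P.prod P) := by
    rw [integral_prod _ hDint]
    refine integral_mono ?_ hDint.integral_prod_left hcenter
    refine integrable_of_abs_le (M := n * (2 * M)) (measurable_finset_sup' hS fun a => Finset.measurable_sum _ fun i _ =>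
      ((hg a).comp (measurable_pi_apply i)).sub_const _) fun x => abs_finset_sup'_le hS fun a => hsum _ fun i => ?_
    have := abs_integral_le_of_abs_le (ν := ν) (hM a)
    exact (abs_sub _ _).trans (by linarith [hM a (x i)])
  set Q := Measure.pi fun _ : Fin n => ν.prod ν
  let E : (Fin n → X × X) → ℝ := fun z => D (fun i => (z i).1, fun i => (z i).2)
  have hEm : Measurable E := hDm.comp
    ((measurable_pi_lambda _ fun i => measurable_fst.comp (measurable_pi_apply i)).prodMk
      (measurable_pi_lambda _ fun i => measurable_snd.comp (measurable_pi_apply i)))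
  have hDE : ∫ p, D p ∂(P.prod P) = ∫ z, E z ∂Q := by
    rw [← (measurePreserving_arrowProdEquivProdArrow X X (Fin n) (fun _ => ν)
      (fun _ => ν)).integral_comp']
    rfl
  let sw : Bool → X × X → X × X := fun b => if b then id else Prod.swap
  have hsw : ∀ b, MeasurePreserving (sw b) (ν.prod ν) (ν.prod ν) := by
    rintro (_ | _)
    · exact Measure.measurePreserving_swap
    · exact MeasurePreserving.id _
  have hswpi : ∀ σ : Fin n → Bool, MeasurePreserving (fun z i => sw (σ i) (z i)) Q Q := fun σ =>
    measurePreserving_pi _ _ fun i => hsw (σ i)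
  have hinv : ∀ σ : Fin n → Bool, ∫ z, E (fun i => sw (σ i) (z i)) ∂Q = ∫ z, E z ∂Q := fun σ => by
    conv_rhs => rw [← (hswpi σ).map_eq]
    rw [integral_map (hswpi σ).aemeasurable hEm.aestronglyMeasurable]
  have hEi : ∀ σ : Fin n → Bool, Integrable (fun z => E (fun i => sw (σ i) (z i))) Q := fun σ =>
    integrable_of_abs_le (hEm.comp (hswpi σ).measurable) fun z => hDb _
  have hpoint : ∀ z : Fin n → X × X, ∑ σ : Fin n → Bool, E (fun i => sw (σ i) (z i)) ≤
      2 ^ Fintype.card (Fin n) * (2 * B) := by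
    intro z
    choose f hfS hf using fun σ : Fin n → Bool => Finset.exists_mem_eq_sup' hS fun a =>
      ∑ i, (g a (sw (σ i) (z i)).1 - g a (sw (σ i) (z i)).2)
    have hE : ∀ σ : Fin n → Bool, E (fun i => sw (σ i) (z i)) =
        (∑ i, boolSign (σ i) * g (f σ) (z i).1) + ∑ i, boolSign (σ i) * -g (f σ) (z i).2 := by
      intro σ
      rw [← Finset.sum_add_distrib]
      refine (hf σ).trans (Finset.sum_congr rfl fun i _ => ?_)
      cases hσ : σ i <;> simp [sw, boolSign, sub_eq_add_neg, add_comm]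
    simp_rw [hE]
    rw [Finset.sum_add_distrib, two_mul, mul_add]
    exact add_le_add (hB (fun i => (z i).1) f hfS) ((hB fun i => (z i).2).neg f hfS)
  have hfin : (2 : ℝ) ^ Fintype.card (Fin n) * ∫ z, E z ∂Q ≤
      2 ^ Fintype.card (Fin n) * (2 * B) := by
    calc (2 : ℝ) ^ Fintype.card (Fin n) * ∫ z, E z ∂Q
        = ∑ σ : Fin n → Bool, ∫ z, E (fun i => sw (σ i) (z i)) ∂Q := by
          simp_rw [hinv]; simp
      _ = ∫ z, ∑ σ : Fin n → Bool, E (fun i => sw (σ i) (z i)) ∂Q :=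
          (integral_finsetSum _ fun σ _ => hEi σ).symm
      _ ≤ ∫ _, 2 ^ Fintype.card (Fin n) * (2 * B) ∂Q :=
          integral_mono (integrable_finsetSum _ fun σ _ => hEi σ) (integrable_const _) hpoint
      _ = 2 ^ Fintype.card (Fin n) * (2 * B) := by simp
  rw [hDE] at hstep1
  exact hstep1.trans (le_of_mul_le_mul_left hfin (by positivity))

/-- Uniform one-sided deviation bound for a finite class of functions. -/
lemma le_measureReal_forall_finset_sum_sub_le (ν : Measure X) [IsProbabilityMeasure ν] {n : ℕ}
    (hn : 0 < n) {S : Finset T} {g : T → X → ℝ} (hg : ∀ a, Measurable (g a)) {m c B η : ℝ}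
    (hm : ∀ a x, g a x ∈ Set.Icc m (m + c)) (hB0 : 0 ≤ B)
    (hB : ∀ x : Fin n → X, RademacherLE (fun a i => g a (x i)) (S : Set T) B)
    (hη : 0 < η) (hη1 : η < 1) :
    1 - η ≤ (Measure.pi fun _ : Fin n => ν).real
      {x | ∀ a ∈ S, ∑ i, (g a (x i) - ∫ z, g a z ∂ν) ≤
        2 * B + c * √(n * Real.log (1 / η) / 2)} := by
  set P := Measure.pi fun _ : Fin n => ν
  set K := 2 * B + c * √(n * Real.log (1 / η) / 2) with hK
  have huniv : (∀ x : Fin n → X, ∀ a ∈ S, ∑ i, (g a (x i) - ∫ z, g a z ∂ν) ≤ K) →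
      1 - η ≤ P.real {x | ∀ a ∈ S, ∑ i, (g a (x i) - ∫ z, g a z ∂ν) ≤ K} := fun h => by
    have : {x : Fin n → X | ∀ a ∈ S, ∑ i, (g a (x i) - ∫ z, g a z ∂ν) ≤ K} = Set.univ :=
      Set.eq_univ_of_forall h
    rw [this, probReal_univ]
    linarith
  rcases S.eq_empty_or_nonempty with rfl | hS
  · exact huniv fun x a ha => absurd ha (Finset.notMem_empty a)
  have hX : Nonempty X := nonempty_of_isProbabilityMeasure ν
  have hc0 : 0 ≤ c := by
    obtain ⟨a, -⟩ := hS
    have := hm a hX.some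
    linarith [this.1, this.2]
  rcases hc0.eq_or_lt with rfl | hc
  · refine huniv fun x a _ => ?_
    have hga : ∀ z, g a z = m := fun z => by
      have := hm a z
      rw [add_zero, Set.Icc_self] at this
      exact this
    simp_rw [hga]
    simpa [hK] using hB0
  have hM : ∀ a x, |g a x| ≤ |m| + c := fun a x => by
    have := hm a x
    rw [abs_le]
    constructor
    · linarith [this.1, neg_abs_le m]
    · linarith [this.2, le_abs_self m]
  let H : (Fin n → X) → ℝ := fun x => S.sup' hS fun a => ∑ i, (g a (x i) - ∫ z, g a z ∂ν)
  have hHm : Measurable H := measurable_finset_sup' hS fun a =>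
    Finset.measurable_sum _ fun i _ => ((hg a).comp (measurable_pi_apply i)).sub_const _
  have hHb : ∀ x, |H x| ≤ n * (2 * (|m| + c)) := fun x => by
    refine abs_finset_sup'_le hS fun a => (Finset.abs_sum_le_sum_abs _ _).trans
      ((Finset.sum_le_sum fun i _ => (?_ : _ ≤ 2 * (|m| + c))).trans (by simp))
    have := abs_integral_le_of_abs_le (ν := ν) (hM a)
    exact (abs_sub _ _).trans (by linarith [hM a (x i)])
  have hHc : ∀ x i y, H (Function.update x i y) - H x ≤ c := by
    intro x i y
    obtain ⟨a, ha, hmax⟩ := Finset.exists_mem_eq_sup' hS fun a =>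
      ∑ j, (g a (Function.update x i y j) - ∫ z, g a z ∂ν)
    have h1 : H (Function.update x i y) = ∑ j, (g a (Function.update x i y j) - ∫ z, g a z ∂ν) :=
      hmax
    have h2 : ∑ j, (g a (x j) - ∫ z, g a z ∂ν) ≤ H x :=
      Finset.le_sup' (fun a => ∑ j, (g a (x j) - ∫ z, g a z ∂ν)) ha
    have h3 : ∑ j, (g a (Function.update x i y j) - ∫ z, g a z ∂ν) -
        ∑ j, (g a (x j) - ∫ z, g a z ∂ν) = g a y - g a (x i) := by
      rw [← Finset.sum_sub_distrib, Finset.sum_eq_single i]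
      · simp
      · intro j _ hj
        simp [Function.update_of_ne hj]
      · simp
    linarith [(hm a y).2, (hm a (x i)).1]
  have hmc := measureReal_add_sqrt_le_le ν hc hη hη1 hn hHm hHb hHc
  have hEH := integral_sup'_sum_sub_le ν hS hg hM hB
  have hbad : P.real {x | K < H x} ≤ η := by
    refine (measureReal_mono fun x hx => ?_).trans hmc
    have hx' : K < H x := hx
    exact (add_le_add_left hEH _).trans hx'.le
  have hset : {x | ∀ a ∈ S, ∑ i, (g a (x i) - ∫ z, g a z ∂ν) ≤ K} = {x | K < H x}ᶜ := by
    ext x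
    simp [H]
  rw [hset, probReal_compl_eq_one_sub (measurableSet_lt measurable_const hHm)]
  linarith

end Symmetrization

/-- The score `1 / (1 + exp (-f x))`. -/
noncomputable def score {X : Type*} (f : X → ℝ) (x : X) : ℝ := 1 / (1 + Real.exp (-f x))

section Score

variable {X : Type*}

lemma score_pos (f : X → ℝ) (x : X) : 0 < score f x := by
  unfold score; positivity

lemma score_lt_one (f : X → ℝ) (x : X) : score f x < 1 := by
  unfold score
  rw [div_lt_one (by positivity)]
  linarith [Real.exp_pos (-f x)]

lemma abs_score_le_one (f : X → ℝ) (x : X) : |score f x| ≤ 1 := by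
  rw [abs_of_pos (score_pos f x)]
  exact (score_lt_one f x).le

lemma lt_score_iff (f : X → ℝ) (x : X) {t : ℝ} (ht : t ∈ Set.Ioo (0 : ℝ) 1) :
    t < score f x ↔ Real.log (t / (1 - t)) < f x := by
  have h0 := ht.1
  have h1 : 0 < 1 - t := sub_pos.2 ht.2
  have hinv : Real.log (t / (1 - t)) = -Real.log ((1 - t) / t) := by
    rw [← Real.log_inv, inv_div]
  rw [hinv, neg_lt, Real.lt_log_iff_exp_lt (by positivity), score, lt_div_iff₀ (by positivity),
    lt_div_iff₀ h0]
  constructor <;> intro h <;> linarith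

lemma score_mem_Icc {f : X → ℝ} {b : ℝ} {x : X} (hb : |f x| ≤ b) :
    score f x ∈ Set.Icc (1 / (1 + Real.exp b)) (1 / (1 + Real.exp b) + min b 1) := by
  obtain ⟨hl, hu⟩ := abs_le.1 hb
  constructor
  · unfold score
    gcongr
    linarith
  have h1 : score f x ≤ 1 / (1 + Real.exp (-b)) := by
    unfold score
    gcongr
  have h2 : 1 / (1 + Real.exp b) = Real.exp (-b) / (1 + Real.exp (-b)) := by
    rw [Real.exp_neg]
    have := Real.exp_pos b
    field_simp
    ring
  have he := Real.exp_pos (-b)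
  have h3 : 1 / (1 + Real.exp (-b)) - Real.exp (-b) / (1 + Real.exp (-b)) ≤ min b 1 := by
    have hb0 : 0 ≤ b := (abs_nonneg _).trans hb
    have he1 : Real.exp (-b) ≤ 1 := Real.exp_le_one_iff.2 (by linarith)
    rw [← sub_div]
    calc (1 - Real.exp (-b)) / (1 + Real.exp (-b)) ≤ 1 - Real.exp (-b) :=
          div_le_self (by linarith) (by linarith)
      _ ≤ min b 1 := le_min (by linarith [Real.add_one_le_exp (-b)]) (by linarith)
  rw [h2]
  linarith

lemma half_le_score {f : X → ℝ} {x : X} (h : 0 ≤ f x) : 1 / 2 ≤ score f x := by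
  unfold score
  have : Real.exp (-f x) ≤ 1 := Real.exp_le_one_iff.2 (by linarith)
  gcongr
  linarith

lemma score_le_half {f : X → ℝ} {x : X} (h : f x ≤ 0) : score f x ≤ 1 / 2 := by
  unfold score
  have : 1 ≤ Real.exp (-f x) := Real.one_le_exp (by linarith)
  gcongr
  linarith

lemma measurable_score [MeasurableSpace X] {f : X → ℝ} (hf : Measurable f) :
    Measurable (score f) :=
  measurable_const.div (measurable_const.add hf.neg.exp)

lemma tendsto_score {g : ℕ → X → ℝ} {f : X → ℝ} {x : X}
    (h : Tendsto (fun k => g k x) atTop (𝓝 (f x))) :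
    Tendsto (fun k => score (g k) x) atTop (𝓝 (score f x)) := by
  refine tendsto_const_nhds.div (tendsto_const_nhds.add ?_) (by positivity)
  exact (Real.continuous_exp.tendsto _).comp h.neg

lemma tendsto_meanScore {g : ℕ → X → ℝ} {f : X → ℝ}
    (h : ∀ x, Tendsto (fun k => g k x) atTop (𝓝 (f x))) {n : ℕ} (x : Fin n → X) :
    Tendsto (fun k => meanScore (g k) x) atTop (𝓝 (meanScore f x)) :=
  (tendsto_finsetSum _ fun i _ => tendsto_score (h (x i))).const_mul _

lemma tendsto_integral_score [MeasurableSpace X] (ν : Measure X) [IsProbabilityMeasure ν]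
    {g : ℕ → X → ℝ} {f : X → ℝ} (hg : ∀ k, Measurable (g k))
    (h : ∀ x, Tendsto (fun k => g k x) atTop (𝓝 (f x))) :
    Tendsto (fun k => ∫ z, score (g k) z ∂ν) atTop (𝓝 (∫ z, score f z ∂ν)) :=
  tendsto_integral_of_dominated_convergence (fun _ => 1)
    (fun k => (measurable_score (hg k)).aestronglyMeasurable) (integrable_const _)
    (fun _ => ae_of_all _ fun _ => abs_score_le_one _ _) (ae_of_all _ fun x => tendsto_score (h x))

/-- The Rademacher average of the scores of a class of finite VC dimension. -/
lemma rademacherLE_score {F G : Set (X → ℝ)} (hG : G ⊆ F) {V : ℕ} (hV : vcDim F ≤ V) {n : ℕ}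
    (x : Fin n → X) (S : Finset G) :
    RademacherLE (fun (f : G) i => score f (x i)) (S : Set G) (16 * √(V * n)) := by
  classical
  refine rademacherLE_of_superlevel
    (fun f i => ⟨(score_pos _ _).le, (score_lt_one _ _).le⟩) fun t ht => ?_
  let A : G → Finset (Fin n) := fun f => {i | t < score f (x i)}
  let p : Fin n → X × ℝ := fun i => (x i, Real.log (t / (1 - t)))
  have hmem : ∀ (f : G) i, i ∈ A f ↔ p i ∈ subgraph f.1 := fun f i => by
    simp [A, p, subgraph, lt_score_iff _ _ ht]
  have hdim : (S.image A).vcDim ≤ V := by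
    refine Finset.sup_le fun s hs => ?_
    rw [Finset.mem_shatterer] at hs
    have hinj : Set.InjOn p s := by
      intro i hi j hj hij
      obtain ⟨u, hu, hsu⟩ := hs.exists_inter_eq_singleton hi
      obtain ⟨f, -, rfl⟩ := Finset.mem_image.1 hu
      have h1 : i ∈ s ∩ A f := by simp [hsu]
      have h2 : j ∈ s ∩ A f := by
        refine Finset.mem_inter.2 ⟨hj, (hmem f j).2 ?_⟩
        rw [← hij]
        exact (hmem f i).1 (Finset.mem_inter.1 h1).2
      rw [hsu, Finset.mem_singleton] at h2
      exact h2.symm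
    have hshat : Shatters (subgraph '' F) (s.image p) := by
      intro u hu
      obtain ⟨w, hw, hsw⟩ := hs (Finset.filter_subset (fun i => p i ∈ u) s)
      obtain ⟨f, -, rfl⟩ := Finset.mem_image.1 hw
      refine ⟨subgraph f.1, ⟨f.1, hG f.2, rfl⟩, fun a ha => ?_⟩
      obtain ⟨i, hi, rfl⟩ := Finset.mem_image.1 ha
      have := congrArg (i ∈ ·) hsw
      simp only [Finset.mem_inter, Finset.mem_filter, hi, true_and, eq_iff_iff] at this
      rw [← hmem, this]
    have hle : ((s.image p).card : ℕ∞) ≤ V :=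
      (le_iSup₂ (f := fun (s : Finset (X × ℝ)) (_ : Shatters (subgraph '' F) s) =>
        (s.card : ℕ∞)) _ hshat).trans hV
    rw [Finset.card_image_of_injOn hinj] at hle
    exact_mod_cast hle
  intro h hh
  have := rademacherLE_indicatorVec hdim (fun σ => A (h σ))
    fun σ => Finset.mem_coe.2 (Finset.mem_image_of_mem A (hh σ))
  simpa [indicatorVec, A] using this

end Score

section Deviation

variable {X : Type*} [MeasurableSpace X]

lemma sqrt_mul_eq_mul_sqrt_div {n : ℝ} (hn : 0 < n) (a : ℝ) : √(a * n) = n * √(a / n) := by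
  have h : a * n = n ^ 2 * (a / n) := by field_simp
  rw [h, Real.sqrt_mul (by positivity), Real.sqrt_sq hn.le]

/-- One-sided deviations of the mean scores, uniformly over a finite class. -/
lemma le_measureReal_forall_finset_meanScore_sub_le (ν : Measure X) [IsProbabilityMeasure ν]
    {F G : Set (X → ℝ)} (hG : G ⊆ F) (hF : ∀ f ∈ F, Measurable f) {b : ℝ}
    (hb : UniformlyBounded F b) {V : ℕ} (hV : vcDim F ≤ V) {n : ℕ} (hn : 0 < n) {δ τ : ℝ}
    (hδ : 0 < δ) (hδ1 : δ < 1) (hτ : τ = 1 ∨ τ = -1) (S : Finset G) :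
    1 - δ / 2 ≤ (Measure.pi fun _ : Fin n => ν).real {x | ∀ f ∈ S,
      τ * (meanScore f.1 x - ∫ z, score f.1 z ∂ν) ≤
        32 * √((V : ℝ) / n) + confidenceTerm b δ n} := by
  have hn0 : (0 : ℝ) < n := by exact_mod_cast hn
  have hrange : ∃ m, ∀ (f : G) x, τ * score f.1 x ∈ Set.Icc m (m + min b 1) := by
    rcases hτ with rfl | rfl
    · exact ⟨_, fun f x => by simpa using score_mem_Icc (hb f (hG f.2) x)⟩
    · refine ⟨-(1 / (1 + Real.exp b) + min b 1), fun f x => ?_⟩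
      obtain ⟨h1, h2⟩ := score_mem_Icc (hb f (hG f.2) x)
      constructor <;> linarith
  obtain ⟨m, hm⟩ := hrange
  have hrad : ∀ x : Fin n → X,
      RademacherLE (fun (f : G) i => τ * score f.1 (x i)) (S : Set G) (16 * √(V * n)) := by
    intro x
    rcases hτ with rfl | rfl
    · simpa using rademacherLE_score hG hV x S
    · simpa using (rademacherLE_score hG hV x S).neg
  have hdev := le_measureReal_forall_finset_sum_sub_le ν hn (S := S)
    (g := fun (f : G) x => τ * score f.1 x) (η := δ / 2)
    (fun f => (measurable_score (hF f (hG f.2))).const_mul τ) hm (by positivity) hrad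
    (by positivity) (by linarith)
  refine hdev.trans (measureReal_mono fun x hx f hf => ?_)
  have h := hx f hf
  rw [Finset.sum_sub_distrib, integral_const_mul, ← Finset.mul_sum, Finset.sum_const,
    Finset.card_univ, Fintype.card_fin, nsmul_eq_mul] at h
  have hmean : ∑ i, score f.1 (x i) = n * meanScore f.1 x := by
    simp only [meanScore, score]
    field_simp
  have hL : (n : ℝ) * Real.log (1 / (δ / 2)) / 2 = Real.log (2 / δ) / 2 * n := by
    rw [one_div_div]; ring
  rw [hmean, hL, sqrt_mul_eq_mul_sqrt_div hn0, sqrt_mul_eq_mul_sqrt_div hn0, div_div] at h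
  refine le_of_mul_le_mul_left ?_ hn0
  unfold confidenceTerm
  linarith

lemma measurable_meanScore {f : X → ℝ} (hf : Measurable f) (n : ℕ) :
    Measurable fun x : Fin n → X => meanScore f x :=
  (Finset.measurable_sum _ fun i _ =>
    (measurable_score hf).comp (measurable_pi_apply i)).const_mul _

/-- One-sided deviations of the mean scores, uniformly over a countable class. -/
lemma le_measureReal_forall_meanScore_sub_le (ν : Measure X) [IsProbabilityMeasure ν]
    {F G : Set (X → ℝ)} (hG : G ⊆ F) (hGc : G.Countable) (hF : ∀ f ∈ F, Measurable f) {b : ℝ}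
    (hb : UniformlyBounded F b) {V : ℕ} (hV : vcDim F ≤ V) {n : ℕ} (hn : 0 < n) {δ τ : ℝ}
    (hδ : 0 < δ) (hδ1 : δ < 1) (hτ : τ = 1 ∨ τ = -1) :
    1 - δ / 2 ≤ (Measure.pi fun _ : Fin n => ν).real {x | ∀ f ∈ G,
      τ * (meanScore f x - ∫ z, score f z ∂ν) ≤
        32 * √((V : ℝ) / n) + confidenceTerm b δ n} := by
  classical
  set K := 32 * √((V : ℝ) / n) + confidenceTerm b δ n
  have hcount : Countable G := hGc
  rcases isEmpty_or_nonempty G with hE | hne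
  · have : {x : Fin n → X | ∀ f ∈ G, τ * (meanScore f x - ∫ z, score f z ∂ν) ≤ K} = Set.univ :=
      Set.eq_univ_of_forall fun x f hf => (hE.false ⟨f, hf⟩).elim
    rw [this, probReal_univ]
    linarith
  obtain ⟨e, he⟩ := exists_surjective_nat G
  let A : ℕ → Set (Fin n → X) := fun k => {x | ∀ f ∈ (Finset.range k).image e,
    τ * (meanScore f.1 x - ∫ z, score f.1 z ∂ν) ≤ K}
  have hAm : ∀ k, MeasurableSet (A k) := fun k => by
    have : A k = ⋂ f ∈ (Finset.range k).image e,
        {x | τ * (meanScore f.1 x - ∫ z, score f.1 z ∂ν) ≤ K} := by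
      ext x; simp [A]
    rw [this]
    refine Finset.measurableSet_biInter _ fun f _ => measurableSet_le ?_ measurable_const
    exact ((measurable_meanScore (hF f (hG f.2)) n).sub_const _).const_mul _
  have hanti : Antitone A := fun k l hkl x hx f hf =>
    hx f (Finset.image_subset_image (Finset.range_subset_range.2 hkl) hf)
  have hset : {x : Fin n → X | ∀ f ∈ G, τ * (meanScore f x - ∫ z, score f z ∂ν) ≤ K} =
      ⋂ k, A k := by
    ext x
    simp only [Set.mem_ofPred_eq, Set.mem_iInter, A]
    constructor
    · exact fun h k f _ => h f f.2
    · intro h f hf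
      obtain ⟨k, hk⟩ := he ⟨f, hf⟩
      exact h (k + 1) ⟨f, hf⟩
        (Finset.mem_image.2 ⟨k, Finset.mem_range.2 (Nat.lt_succ_self k), hk⟩)
  have hlim := tendsto_measure_iInter_atTop (μ := Measure.pi fun _ : Fin n => ν)
    (fun k => (hAm k).nullMeasurableSet) hanti ⟨0, measure_ne_top _ _⟩
  rw [hset]
  exact ge_of_tendsto ((ENNReal.tendsto_toReal (measure_ne_top _ _)).comp hlim)
    (Eventually.of_forall fun k => le_measureReal_forall_finset_meanScore_sub_le ν hG hF hb hV hn
      hδ hδ1 hτ _)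

/-- One-sided deviations of the mean scores on an i.i.d. sample, uniformly over a pointwise
measurable class. -/
lemma exists_event_forall_meanScore_sub_le {ν : Measure X} [IsProbabilityMeasure ν]
    {F : Set (X → ℝ)} (hF : PointwiseMeasurable F) {b : ℝ} (hb : UniformlyBounded F b) {V : ℕ}
    (hV : vcDim F ≤ V) {n : ℕ} (hn : 0 < n) {Ω : Type*} [MeasurableSpace Ω] {μ : Measure Ω}
    [IsProbabilityMeasure μ] {x : Fin n → Ω → X} (hx : IsIIDSample μ x ν) {δ τ : ℝ}
    (hδ : 0 < δ) (hδ1 : δ < 1) (hτ : τ = 1 ∨ τ = -1) :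
    ∃ E : Set Ω, MeasurableSet E ∧ 1 - δ / 2 ≤ μ.real E ∧ ∀ ω ∈ E, ∀ f ∈ F,
      τ * (meanScore f (fun i => x i ω) - ∫ z, score f z ∂ν) ≤
        32 * √((V : ℝ) / n) + confidenceTerm b δ n := by
  obtain ⟨hFm, G, hG, hGc, hGF⟩ := hF
  obtain ⟨hxm, hind, hlaw⟩ := hx
  set K := 32 * √((V : ℝ) / n) + confidenceTerm b δ n
  have hpi : μ.map (fun ω i => x i ω) = Measure.pi fun _ : Fin n => ν := by
    rw [(iIndepFun_iff_map_fun_eq_pi_map fun i => (hxm i).aemeasurable).1 hind]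
    simp_rw [hlaw]
  have hmap : Measurable fun ω i => x i ω := measurable_pi_lambda _ hxm
  have hAm : MeasurableSet {y : Fin n → X | ∀ f ∈ G,
      τ * (meanScore f y - ∫ z, score f z ∂ν) ≤ K} := by
    have : {y : Fin n → X | ∀ f ∈ G, τ * (meanScore f y - ∫ z, score f z ∂ν) ≤ K} =
        ⋂ f ∈ G, {y | τ * (meanScore f y - ∫ z, score f z ∂ν) ≤ K} := by
      ext y; simp
    rw [this]
    refine MeasurableSet.biInter hGc fun f hf => measurableSet_le ?_ measurable_const
    exact ((measurable_meanScore (hFm f (hG hf)) n).sub_const _).const_mul _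
  refine ⟨_, hmap hAm, ?_, fun ω hω f hf => ?_⟩
  · rw [← map_measureReal_apply hmap hAm, hpi]
    exact le_measureReal_forall_meanScore_sub_le ν hG hGc hFm hb hV hn hδ hδ1 hτ
  · obtain ⟨g, hgG, hgf⟩ := hGF f hf
    have hlim := ((tendsto_meanScore hgf fun i => x i ω).sub
      (tendsto_integral_score ν (fun k => hFm _ (hG (hgG k))) hgf)).const_mul τ
    exact le_of_tendsto hlim (Eventually.of_forall fun k => hω (g k) (hgG k))

end Deviation

section Risk

variable {X : Type*} [MeasurableSpace X]

lemma measurableSet_label : MeasurableSet {z : X × Fin 2 | z.2 = 1} :=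
  measurable_snd (measurableSet_singleton 1)

lemma isProbabilityMeasure_posLaw (P : Measure (X × Fin 2)) [IsProbabilityMeasure P]
    (hP : 0 < classPrior P) : IsProbabilityMeasure (posLaw P) := by
  have hne : P {z | z.2 = 1} ≠ 0 := fun h => by simp [classPrior, measureReal_def, h] at hP
  have := cond_isProbabilityMeasure hne
  exact Measure.isProbabilityMeasure_map measurable_fst.aemeasurable

lemma isProbabilityMeasure_inputLaw (P : Measure (X × Fin 2)) [IsProbabilityMeasure P] :
    IsProbabilityMeasure (inputLaw P) :=
  Measure.isProbabilityMeasure_map measurable_fst.aemeasurable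

lemma classPrior_mul_integral_posLaw (P : Measure (X × Fin 2)) (hP : 0 < classPrior P)
    {h : X → ℝ} (hh : Measurable h) :
    classPrior P * ∫ x, h x ∂(posLaw P) = ∫ z in {z | z.2 = 1}, h z.1 ∂P := by
  rw [posLaw, integral_map measurable_fst.aemeasurable hh.aestronglyMeasurable,
    ProbabilityTheory.cond, integral_smul_measure, smul_eq_mul, ENNReal.toReal_inv, ← mul_assoc]
  have : classPrior P * ((P {z | z.2 = 1}).toReal)⁻¹ = 1 := mul_inv_cancel₀ hP.ne'
  rw [this, one_mul]

lemma zeroOneError_predictedLabel_le {X : Type*} (f : X → ℝ) (z : X × Fin 2) :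
    zeroOneError (predictedLabel f z.1) ((z.2 : ℕ) : ℝ) ≤
      2 * score f z.1 + {z : X × Fin 2 | z.2 = 1}.indicator (fun z => 2 - 4 * score f z.1) z := by
  obtain ⟨x, y⟩ := z
  have h0 := score_pos f x
  have h1 := score_lt_one f x
  rcases lt_trichotomy (f x) 0 with h | h | h
  · have := score_le_half h.le
    fin_cases y <;> simp [zeroOneError, predictedLabel, Real.sign_of_neg h, Set.indicator] <;>
      linarith
  · have h2 := half_le_score h.ge
    have h3 := score_le_half h.le
    fin_cases y <;> simp [zeroOneError, predictedLabel, h, Set.indicator] <;> linarith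
  · have := half_le_score h.le
    fin_cases y <;> simp [zeroOneError, predictedLabel, Real.sign_of_pos h, Set.indicator] <;>
      linarith

/-- The expected risk is controlled by the mean scores under the two sampling laws. -/
lemma expectedRisk_le (P : Measure (X × Fin 2)) [IsProbabilityMeasure P]
    (hP : 0 < classPrior P) {f : X → ℝ} (hf : Measurable f) :
    expectedRisk P f ≤ 4 * classPrior P * (1 - ∫ x, score f x ∂(posLaw P)) +
      2 * (∫ x, score f x ∂(inputLaw P) - classPrior P) := by
  have hs : Measurable fun z : X × Fin 2 => score f z.1 := (measurable_score hf).comp measurable_fst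
  have hsi : Integrable (fun z : X × Fin 2 => score f z.1) P :=
    integrable_of_abs_le hs fun z => abs_score_le_one f z.1
  have hti : Integrable (fun z : X × Fin 2 => 2 - 4 * score f z.1) P :=
    (integrable_const _).sub (hsi.const_mul 4)
  have hle : expectedRisk P f ≤ ∫ z, (2 * score f z.1 +
      {z : X × Fin 2 | z.2 = 1}.indicator (fun z => 2 - 4 * score f z.1) z) ∂P := by
    refine integral_mono_of_nonneg (ae_of_all _ fun z => ?_)
      ((hsi.const_mul 2).add (hti.indicator measurableSet_label))
      (ae_of_all _ (zeroOneError_predictedLabel_le f))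
    simp only [zeroOneError, Pi.zero_apply]
    split_ifs <;> norm_num
  refine hle.trans_eq ?_
  rw [integral_add (hsi.const_mul 2) (hti.indicator measurableSet_label), integral_const_mul,
    integral_indicator measurableSet_label,
    integral_sub (integrable_const _) (hsi.const_mul 4).integrableOn, integral_const_mul,
    ← classPrior_mul_integral_posLaw P hP (measurable_score hf), setIntegral_const, smul_eq_mul,
    inputLaw, integral_map measurable_fst.aemeasurable (measurable_score hf).aestronglyMeasurable]
  unfold classPrior
  ring

end Risk

end DistPU

theorem proposition1 :
    ∃ C : ℝ, 0 < C ∧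
      ∀ (X : Type*) [MeasurableSpace X]
        (P : Measure (X × Fin 2)) [IsProbabilityMeasure P] (_ : 0 < DistPU.classPrior P)
        (F : Set (X → ℝ)) (_ : DistPU.PointwiseMeasurable F)
        (b : ℝ) (_ : DistPU.UniformlyBounded F b)
        (V : ℕ) (_ : DistPU.vcDim F = (V : ℕ∞))
        (nL nU : ℕ) (_ : 0 < nL) (_ : 0 < nU)
        (Ω : Type*) [MeasurableSpace Ω] (μ : Measure Ω) [IsProbabilityMeasure μ]
        (xL : Fin nL → Ω → X) (_ : DistPU.IsIIDSample μ xL (DistPU.posLaw P))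
        (xU : Fin nU → Ω → X) (_ : DistPU.IsIIDSample μ xU (DistPU.inputLaw P))
        (δ : ℝ) (_ : 0 < δ) (_ : δ < 1),
        ∃ E : Set Ω, MeasurableSet E ∧ 1 - δ ≤ μ.real E ∧
          ∀ ω ∈ E, ∀ f ∈ F,
            DistPU.expectedRisk P f ≤
              2 * DistPU.empiricalLabRisk (DistPU.classPrior P) f
                  (fun i => xL i ω) (fun j => xU j ω)
                + 8 * DistPU.classPrior P * (C * Real.sqrt ((V : ℝ) / (nL : ℝ)))
                + 12 * DistPU.classPrior P * DistPU.confidenceTerm b δ nL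
                + 4 * (C * Real.sqrt ((V : ℝ) / (nU : ℝ)))
                + 6 * DistPU.confidenceTerm b δ nU := by
  refine ⟨16, by norm_num, ?_⟩
  intro X _ P _ hP F hF b hb V hV nL nU hnL hnU Ω _ μ _ xL hxL xU hxU δ hδ hδ1
  have := DistPU.isProbabilityMeasure_posLaw P hP
  have := DistPU.isProbabilityMeasure_inputLaw P
  obtain ⟨EL, hELm, hEL, hdevL⟩ := DistPU.exists_event_forall_meanScore_sub_le hF hb hV.le hnL hxL
    hδ hδ1 (Or.inl rfl)
  obtain ⟨EU, hEUm, hEU, hdevU⟩ := DistPU.exists_event_forall_meanScore_sub_le hF hb hV.le hnU hxU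
    hδ hδ1 (Or.inr rfl)
  refine ⟨EL ∩ EU, hELm.inter hEUm, ?_, fun ω hω f hf => ?_⟩
  · have h1 := measureReal_union_add_inter (μ := μ) (s := EL) hEUm
    have h2 : μ.real (EL ∪ EU) ≤ 1 := measureReal_le_one
    linarith
  have hX : Nonempty X := nonempty_of_isProbabilityMeasure (DistPU.posLaw P)
  have hb0 : 0 ≤ min b 1 := le_min ((abs_nonneg _).trans (hb f hf hX.some)) zero_le_one
  have hεL : 0 ≤ DistPU.confidenceTerm b δ nL := mul_nonneg hb0 (Real.sqrt_nonneg _)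
  have hεU : 0 ≤ DistPU.confidenceTerm b δ nU := mul_nonneg hb0 (Real.sqrt_nonneg _)
  have hR := DistPU.expectedRisk_le P hP (hF.1 f hf)
  have hL := hdevL ω hω.1 f hf
  have hU := hdevU ω hω.2 f hf
  have habsL := neg_abs_le (DistPU.meanScore f (fun i => xL i ω) - 1)
  have habsU := le_abs_self (DistPU.meanScore f (fun j => xU j ω) - DistPU.classPrior P)
  unfold DistPU.empiricalLabRisk
  have hL' := mul_le_mul_of_nonneg_left
    (show 1 - ∫ z, DistPU.score f z ∂(DistPU.posLaw P) ≤
      |DistPU.meanScore f (fun i => xL i ω) - 1| + (32 * √((V : ℝ) / nL) +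
        3 * DistPU.confidenceTerm b δ nL) by linarith) hP.le
  linarith
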